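/- Let $W:\mathbb{R}\to\mathbb{R}$ be measurable, bounded and $1$-periodic. Let $f:\mathbb{R}\to\mathbb{R}$ be measurable with $c\,\chi_J\le f\le C\,\chi_{[0,1]}$ for some constants $C\ge c>0$ and some non-trivial interval $J\subset[0,1]$. Let $\mu$ be a Borel probability measure on $\mathbb{R}$ whose support $\operatorname{supp}\mu$ is not a discrete set. (These are the data of the continuum one-dimensional Anderson model $-\frac{d^2}{dx^2}+W+\sum_{n\in\mathbb{Z}}\eta_n f(\cdot-n)$ with i.i.d. coupling constants $\eta_n$ of distribution $\mu$.) For $\eta,E\in\mathbb{R}$ let $T(\eta,E)\in SL(2,\mathbb{R})$ be the transfer matrix from $0$ to $1$, that is, the matrix with $$T(\eta,E)\begin{pmatrix}u(0)\\u'(0)\end{pmatrix}=\begin{pmatrix}u(1)\\u'(1)\end{pmatrix}$$ for all solutions $u$ (with $u,u'$ absolutely continuous) of $-u''+Wu+\eta fu=Eu$ on $[0,1]$. Let the Furstenberg group $G(E)$ be the closed subgroup of $SL(2,\mathbb{R})$ generated by the matrices $T(\eta,E)$, $\eta\in\operatorname{supp}\mu$. Then for every $E\in\mathbb{R}$ the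 group $G(E)$ is non-compact and strongly irreducible, the latter meaning that there is no finite non-empty family $V_1,\dots,V_k$ of subspaces of $\mathbb{R}^2$, all different from $\{0\}$ and $\mathbb{R}^2$, such that $A(V_1\cup\dots\cup V_k)=V_1\cup\dots\cup V_k$ for all $A\in G(E)$. -/

import Mathlib

open MeasureTheory Matrix

/-- `u` is a solution on `[0,1]` of `-u'' + q u = 0`, with `p` as its derivative: `u` and `p` are
absolutely continuous, and `u' = p`, `p' = q u` almost everywhere. (As `p` is continuous, `u` is
then `C¹` on `[0,1]` with derivative `p` everywhere, one-sided at the endpoints.) -/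
structure IsSolutionOnUnitInterval (q u p : ℝ → ℝ) : Prop where
  ac_u : AbsolutelyContinuousOnInterval u 0 1
  ac_p : AbsolutelyContinuousOnInterval p 0 1
  deriv_u : ∀ᵐ x : ℝ, x ∈ Set.Icc (0 : ℝ) 1 → HasDerivAt u (p x) x
  deriv_p : ∀ᵐ x : ℝ, x ∈ Set.Icc (0 : ℝ) 1 → HasDerivAt p (q x * u x) x

/-- `T` is the transfer matrix from `0` to `1` of `-u'' + q u = 0`: there is a solution with
`(u(0), u'(0)) = v` and `(u(1), u'(1)) = w` exactly when `w = T v`. -/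
def IsTransferMatrix (q : ℝ → ℝ) (T : Matrix (Fin 2) (Fin 2) ℝ) : Prop :=
  ∀ v w : Fin 2 → ℝ,
    (∃ u p : ℝ → ℝ, IsSolutionOnUnitInterval q u p ∧ ![u 0, p 0] = v ∧ ![u 1, p 1] = w) ↔
      T *ᵥ v = w

/-- The Furstenberg group at energy `E`: the closed subgroup of `SL(2,ℝ)` generated by the transfer
matrices of `-u'' + W u + η f u = E u` from `0` to `1`, with `η` in the support of `μ`. -/
noncomputable def furstenbergGroup (W f : ℝ → ℝ) (μ : Measure ℝ) (E : ℝ) :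
    Subgroup (SpecialLinearGroup (Fin 2) ℝ) :=
  (Subgroup.closure {T : SpecialLinearGroup (Fin 2) ℝ |
    ∃ η ∈ μ.support, IsTransferMatrix (fun x => W x + η * f x - E)
      (T : Matrix (Fin 2) (Fin 2) ℝ)}).topologicalClosure

/-- A set `S` of matrices in `SL(2,ℝ)` is strongly irreducible if there is no finite non-empty
family of subspaces of `ℝ²`, all different from `0` and `ℝ²`, whose union is mapped onto itself by
every element of `S`. -/
def IsStronglyIrreducible (S : Set (SpecialLinearGroup (Fin 2) ℝ)) : Prop :=
  ¬ ∃ F : Set (Submodule ℝ (Fin 2 → ℝ)), F.Finite ∧ F.Nonempty ∧ (∀ V ∈ F, V ≠ ⊥ ∧ V ≠ ⊤) ∧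
    ∀ A ∈ S, (fun x : Fin 2 → ℝ => (A : Matrix (Fin 2) (Fin 2) ℝ) *ᵥ x) ''
      (⋃ V ∈ F, (V : Set (Fin 2 → ℝ))) = ⋃ V ∈ F, (V : Set (Fin 2 → ℝ))

/-! Since the support of `μ` is not discrete, it accumulates at some `η₀`. Both claims concern the
curve of transfer matrices `T η` near `η₀`.

Strong irreducibility: let `u_η` be the solution with fixed initial data `v ≠ 0` and coupling `η`.
The Wronskian of `u_η` and `u_η₀` vanishes at `0` and equals `(η₀ - η) ∫ f u_η u_η₀` at `1`. As `η →
η₀` the integral tends to `∫ f u_η₀² > 0`, so `T η v` and `T η₀ v` are not parallel for `η ≠ η₀`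
close to `η₀` (`eventually_transfer_not_parallel`). Hence `T η v` eventually leaves each of finitely
many lines, whereas an invariant finite family would have to contain it for couplings in the support
accumulating at `η₀`.

Non-compactness: a compact group preserves a definite form `Q` (`exists_invariant_form`). The
entries of `T` are entire in the coupling, so `T Q Tᵀ = Q`, valid on a set accumulating at `η₀`,
holds for every coupling, and the entries are bounded on the real line. The Volterra series shows
that they have order at most `1/2`, so by Phragmén–Lindelöf and Liouville they are constant
(`apply_eq_apply_of_bounded_on_real_of_exp_sqrt`). A constant `T` contradicts the first part. -/

/-! ### Volterra series for `u'' = q u` with a bounded complex potential. -/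

/-- The `n`-th Picard iterate of the Volterra equation of `u'' = q u`, `u 0 = a`, `u' 0 = b`. -/
noncomputable def volterraTerm (q : ℝ → ℂ) (a b : ℂ) : ℕ → ℝ → ℂ
  | 0, x => a + b * x
  | n + 1, x => ∫ s in (0 : ℝ)..x, ∫ t in (0 : ℝ)..s, q t * volterraTerm q a b n t

/-- The solution on `[0,1]` of `u'' = q u`, `u 0 = a`, `u' 0 = b`. -/
noncomputable def volterraSolution (q : ℝ → ℂ) (a b : ℂ) (x : ℝ) : ℂ :=
  ∑' n, volterraTerm q a b n x

/-- The derivative on `[0,1]` of `volterraSolution q a b`. -/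
noncomputable def volterraDeriv (q : ℝ → ℂ) (a b : ℂ) (x : ℝ) : ℂ :=
  b + ∫ t in (0 : ℝ)..x, q t * volterraSolution q a b t

theorem norm_integral_le_pow_div_factorial {g : ℝ → ℂ} {M : ℝ} {m : ℕ}
    (hg : ∀ t ∈ Set.Icc (0 : ℝ) 1, ‖g t‖ ≤ M * (t ^ m / m.factorial))
    {x : ℝ} (hx : x ∈ Set.Icc (0 : ℝ) 1) :
    ‖∫ t in (0 : ℝ)..x, g t‖ ≤ M * (x ^ (m + 1) / (m + 1).factorial) := by
  have h1 : ‖∫ t in (0 : ℝ)..x, g t‖ ≤ ∫ t in (0 : ℝ)..x, M * (t ^ m / m.factorial) := by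
    apply intervalIntegral.norm_integral_le_of_norm_le hx.1
    · filter_upwards with t ht
      exact hg t ⟨ht.1.le, ht.2.trans hx.2⟩
    · exact Continuous.intervalIntegrable (by fun_prop) _ _
  refine h1.trans_eq ?_
  rw [intervalIntegral.integral_const_mul, intervalIntegral.integral_div, integral_pow,
    Nat.factorial_succ]
  push_cast
  have : (m.factorial : ℝ) ≠ 0 := by positivity
  have : (m + 1 : ℝ) ≠ 0 := by positivity
  field_simp
  simp

/-- One Picard step costs a factor `K` and integrates twice. The resulting denominators `(2n)!`,
rather than `n!`, are what give order `1/2` in the coupling. -/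
theorem norm_double_integral_le {q w : ℝ → ℂ} {K M : ℝ} {m : ℕ} (hK : ∀ x, ‖q x‖ ≤ K)
    (hw : ∀ t ∈ Set.Icc (0 : ℝ) 1, ‖w t‖ ≤ M * (t ^ m / m.factorial))
    {x : ℝ} (hx : x ∈ Set.Icc (0 : ℝ) 1) :
    ‖∫ s in (0 : ℝ)..x, ∫ t in (0 : ℝ)..s, q t * w t‖
      ≤ K * M * (x ^ (m + 2) / (m + 2).factorial) := by
  apply norm_integral_le_pow_div_factorial _ hx
  intro s hs
  apply norm_integral_le_pow_div_factorial _ hs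
  intro t ht
  rw [norm_mul, mul_assoc]
  exact mul_le_mul (hK t) (hw t ht) (norm_nonneg _) ((norm_nonneg _).trans (hK t))

theorem IntervalIntegrable.bounded_mul {R : Type*} [NormedRing R] {q w : ℝ → R} {K x y : ℝ}
    (hw : IntervalIntegrable w volume x y) (hq : AEStronglyMeasurable q)
    (hK : ∀ x, ‖q x‖ ≤ K) : IntervalIntegrable (fun t => q t * w t) volume x y := by
  constructor
  · exact hw.1.bdd_mul (c := K) hq.restrict (by filter_upwards with t using hK t)
  · exact hw.2.bdd_mul (c := K) hq.restrict (by filter_upwards with t using hK t)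

section

variable {q : ℝ → ℂ} {K : ℝ}

theorem intervalIntegrable_mul_of_continuous (hq : AEStronglyMeasurable q) (hK : ∀ x, ‖q x‖ ≤ K)
    {w : ℝ → ℂ} (hw : Continuous w) (x y : ℝ) :
    IntervalIntegrable (fun t => q t * w t) volume x y :=
  (hw.intervalIntegrable x y).bounded_mul hq hK

theorem intervalIntegrable_mul_of_continuousOn (hq : AEStronglyMeasurable q) (hK : ∀ x, ‖q x‖ ≤ K)
    {w : ℝ → ℂ} (hw : ContinuousOn w (Set.Icc 0 1)) {x : ℝ} (hx : x ∈ Set.Icc (0 : ℝ) 1) :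
    IntervalIntegrable (fun t => q t * w t) volume 0 x := by
  have : IntervalIntegrable w volume 0 x := by
    apply ContinuousOn.intervalIntegrable
    rw [Set.uIcc_of_le hx.1]
    exact hw.mono (Set.Icc_subset_Icc_right hx.2)
  exact this.bounded_mul hq hK

theorem continuous_integral_mul (hq : AEStronglyMeasurable q) (hK : ∀ x, ‖q x‖ ≤ K)
    {w : ℝ → ℂ} (hw : Continuous w) : Continuous fun x => ∫ t in (0 : ℝ)..x, q t * w t :=
  intervalIntegral.continuous_primitive (intervalIntegrable_mul_of_continuous hq hK hw) 0

theorem continuous_integral_integral_mul (hq : AEStronglyMeasurable q) (hK : ∀ x, ‖q x‖ ≤ K)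
    {w : ℝ → ℂ} (hw : Continuous w) :
    Continuous fun x => ∫ s in (0 : ℝ)..x, ∫ t in (0 : ℝ)..s, q t * w t :=
  intervalIntegral.continuous_primitive
    (fun _ _ => (continuous_integral_mul hq hK hw).intervalIntegrable _ _) 0

variable (a b : ℂ)

theorem continuous_volterraTerm (hq : AEStronglyMeasurable q) (hK : ∀ x, ‖q x‖ ≤ K) (n : ℕ) :
    Continuous (volterraTerm q a b n) := by
  induction n with
  | zero => simp only [volterraTerm]; fun_prop
  | succ n ih => exact continuous_integral_integral_mul hq hK ih

theorem norm_volterraTerm_le (hK : ∀ x, ‖q x‖ ≤ K) (n : ℕ) {x : ℝ}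
    (hx : x ∈ Set.Icc (0 : ℝ) 1) :
    ‖volterraTerm q a b n x‖
      ≤ K ^ n * (‖a‖ + ‖b‖) * (x ^ (2 * n) / (2 * n).factorial) := by
  induction n generalizing x with
  | zero =>
    simp only [volterraTerm]
    refine (norm_add_le _ _).trans ?_
    have : ‖b * (x : ℂ)‖ ≤ ‖b‖ := by
      rw [norm_mul, Complex.norm_real, Real.norm_of_nonneg hx.1]
      exact mul_le_of_le_one_right (norm_nonneg _) hx.2
    simpa using this
  | succ n ih =>
    have := norm_double_integral_le hK (fun t ht => ih ht) hx
    rw [pow_succ', mul_assoc (K : ℝ)]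
    exact this

/-- Written in powers of `√K` so that the bounds sum to `cosh √K`. -/
theorem norm_volterraTerm_le' (hK : ∀ x, ‖q x‖ ≤ K) (n : ℕ) {x : ℝ}
    (hx : x ∈ Set.Icc (0 : ℝ) 1) :
    ‖volterraTerm q a b n x‖ ≤ (‖a‖ + ‖b‖) * (√K ^ (2 * n) / (2 * n).factorial) := by
  have hK0 : 0 ≤ K := (norm_nonneg _).trans (hK 0)
  refine (norm_volterraTerm_le a b hK n hx).trans ?_
  rw [pow_mul √K, Real.sq_sqrt hK0]
  have : x ^ (2 * n) ≤ 1 := pow_le_one₀ hx.1 hx.2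
  calc _ ≤ K ^ n * (‖a‖ + ‖b‖) * (1 / (2 * n).factorial) := by gcongr
    _ = _ := by ring

theorem hasSum_volterra_bound (A k : ℝ) :
    HasSum (fun n : ℕ => A * (k ^ (2 * n) / (2 * n).factorial)) (A * Real.cosh k) :=
  (Real.hasSum_cosh k).mul_left A

theorem hasSum_volterraSolution (hK : ∀ x, ‖q x‖ ≤ K) {x : ℝ} (hx : x ∈ Set.Icc (0 : ℝ) 1) :
    HasSum (fun n => volterraTerm q a b n x) (volterraSolution q a b x) :=
  (Summable.of_norm_bounded (hasSum_volterra_bound _ _).summable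
    fun n => norm_volterraTerm_le' a b hK n hx).hasSum

theorem norm_volterraSolution_le (hK : ∀ x, ‖q x‖ ≤ K) {x : ℝ} (hx : x ∈ Set.Icc (0 : ℝ) 1) :
    ‖volterraSolution q a b x‖ ≤ (‖a‖ + ‖b‖) * Real.cosh √K :=
  tsum_of_norm_bounded (hasSum_volterra_bound _ _) fun n => norm_volterraTerm_le' a b hK n hx

theorem continuousOn_volterraSolution (hq : AEStronglyMeasurable q) (hK : ∀ x, ‖q x‖ ≤ K) :
    ContinuousOn (volterraSolution q a b) (Set.Icc 0 1) :=
  continuousOn_tsum (fun n => (continuous_volterraTerm a b hq hK n).continuousOn)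
    (hasSum_volterra_bound _ _).summable fun n _ hx => norm_volterraTerm_le' a b hK n hx

theorem hasSum_integral_volterraTerm (hq : AEStronglyMeasurable q) (hK : ∀ x, ‖q x‖ ≤ K)
    {x : ℝ} (hx : x ∈ Set.Icc (0 : ℝ) 1) :
    HasSum (fun n => ∫ t in (0 : ℝ)..x, q t * volterraTerm q a b n t)
      (∫ t in (0 : ℝ)..x, q t * volterraSolution q a b t) := by
  have hmem : ∀ t ∈ Set.uIoc 0 x, t ∈ Set.Icc (0 : ℝ) 1 := by
    intro t ht
    rw [Set.uIoc_of_le hx.1] at ht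
    exact ⟨ht.1.le, ht.2.trans hx.2⟩
  refine intervalIntegral.hasSum_integral_of_dominated_convergence
    (fun n _ => K * ((‖a‖ + ‖b‖) * (√K ^ (2 * n) / (2 * n).factorial))) ?_ ?_ ?_ ?_ ?_
  · exact fun n => (hq.mul (continuous_volterraTerm a b hq hK n).aestronglyMeasurable).restrict
  · intro n
    filter_upwards with t ht
    rw [norm_mul]
    exact mul_le_mul (hK t) (norm_volterraTerm_le' a b hK n (hmem t ht)) (norm_nonneg _)
      ((norm_nonneg _).trans (hK t))
  · filter_upwards with t ht
    exact ((hasSum_volterra_bound _ _).mul_left K).summable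
  · exact continuous_const.intervalIntegrable _ _
  · filter_upwards with t ht
    exact (hasSum_volterraSolution a b hK (hmem t ht)).mul_left _

theorem norm_integral_volterraTerm_le (hK : ∀ x, ‖q x‖ ≤ K) (n : ℕ) {x : ℝ}
    (hx : x ∈ Set.Icc (0 : ℝ) 1) :
    ‖∫ t in (0 : ℝ)..x, q t * volterraTerm q a b n t‖
      ≤ K * (‖a‖ + ‖b‖) * (√K ^ (2 * n) / (2 * n).factorial) := by
  have hK0 : 0 ≤ K := (norm_nonneg _).trans (hK 0)
  have := intervalIntegral.norm_integral_le_of_norm_le_const (a := 0) (b := x)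
    (f := fun t => q t * volterraTerm q a b n t)
    (C := K * (‖a‖ + ‖b‖) * (√K ^ (2 * n) / (2 * n).factorial)) (by
      intro t ht
      rw [Set.uIoc_of_le hx.1] at ht
      rw [norm_mul, mul_assoc]
      exact mul_le_mul (hK t) (norm_volterraTerm_le' a b hK n ⟨ht.1.le, ht.2.trans hx.2⟩)
        (norm_nonneg _) hK0)
  refine this.trans (mul_le_of_le_one_right (by positivity) ?_)
  rw [sub_zero, abs_of_nonneg hx.1]
  exact hx.2

theorem norm_integral_volterraSolution_le (hq : AEStronglyMeasurable q) (hK : ∀ x, ‖q x‖ ≤ K)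
    {x : ℝ} (hx : x ∈ Set.Icc (0 : ℝ) 1) :
    ‖∫ t in (0 : ℝ)..x, q t * volterraSolution q a b t‖
      ≤ K * (‖a‖ + ‖b‖) * Real.cosh √K := by
  rw [← (hasSum_integral_volterraTerm a b hq hK hx).tsum_eq]
  exact tsum_of_norm_bounded (hasSum_volterra_bound _ _)
    fun n => norm_integral_volterraTerm_le a b hK n hx

theorem volterraSolution_eq (hq : AEStronglyMeasurable q) (hK : ∀ x, ‖q x‖ ≤ K)
    {x : ℝ} (hx : x ∈ Set.Icc (0 : ℝ) 1) :
    volterraSolution q a b x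
      = a + b * x + ∫ s in (0 : ℝ)..x, ∫ t in (0 : ℝ)..s, q t * volterraSolution q a b t := by
  have hmem : ∀ t ∈ Set.uIoc 0 x, t ∈ Set.Icc (0 : ℝ) 1 := by
    intro t ht
    rw [Set.uIoc_of_le hx.1] at ht
    exact ⟨ht.1.le, ht.2.trans hx.2⟩
  have h : HasSum (fun n => volterraTerm q a b (n + 1) x)
      (∫ s in (0 : ℝ)..x, ∫ t in (0 : ℝ)..s, q t * volterraSolution q a b t) := by
    refine intervalIntegral.hasSum_integral_of_dominated_convergence
      (fun n _ => K * (‖a‖ + ‖b‖) * (√K ^ (2 * n) / (2 * n).factorial)) ?_ ?_ ?_ ?_ ?_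
    · exact fun n => (continuous_integral_mul hq hK
        (continuous_volterraTerm a b hq hK n)).aestronglyMeasurable
    · intro n
      filter_upwards with t ht using norm_integral_volterraTerm_le a b hK n (hmem t ht)
    · filter_upwards with t ht using (hasSum_volterra_bound _ _).summable
    · exact continuous_const.intervalIntegrable _ _
    · filter_upwards with t ht using hasSum_integral_volterraTerm a b hq hK (hmem t ht)
  have h0 := (hasSum_volterraSolution a b hK hx).summable.tsum_eq_zero_add
  rw [h.tsum_eq] at h0
  exact h0

/-- Substituting the equation into itself `n` times bounds `w` by `M K ^ n / (2n)!`, which tends to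
`0`. -/
theorem eq_zero_of_volterra {w : ℝ → ℂ} (hK : ∀ x, ‖q x‖ ≤ K)
    (hw : ContinuousOn w (Set.Icc 0 1))
    (heq : ∀ x ∈ Set.Icc (0 : ℝ) 1,
      w x = ∫ s in (0 : ℝ)..x, ∫ t in (0 : ℝ)..s, q t * w t)
    {x : ℝ} (hx : x ∈ Set.Icc (0 : ℝ) 1) : w x = 0 := by
  have hK0 : 0 ≤ K := (norm_nonneg _).trans (hK 0)
  obtain ⟨M, hM⟩ := isCompact_Icc.exists_bound_of_continuousOn hw
  have hM0 : 0 ≤ M := (norm_nonneg _).trans (hM x hx)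
  have key : ∀ n : ℕ, ∀ x ∈ Set.Icc (0 : ℝ) 1,
      ‖w x‖ ≤ K ^ n * M * (x ^ (2 * n) / (2 * n).factorial) := by
    intro n
    induction n with
    | zero => intro x hx; simpa using hM x hx
    | succ n ih =>
      intro x hx
      rw [heq x hx, pow_succ', mul_assoc (K : ℝ)]
      exact norm_double_integral_le hK ih hx
  have key' : ∀ n : ℕ, ‖w x‖ ≤ M * (√K ^ (2 * n) / (2 * n).factorial) := by
    intro n
    refine (key n x hx).trans ?_
    rw [pow_mul √K, Real.sq_sqrt hK0]
    have : x ^ (2 * n) ≤ 1 := pow_le_one₀ hx.1 hx.2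
    calc _ ≤ K ^ n * M * (1 / (2 * n).factorial) := by gcongr
      _ = _ := by ring
  have := ge_of_tendsto' (hasSum_volterra_bound M √K).summable.tendsto_atTop_zero key'
  exact norm_le_zero_iff.1 this

end

/-! ### Entire dependence on the coupling, and its growth. -/

/-- The complex potential `g + z h`. -/
def affinePotential (g h : ℝ → ℝ) (z : ℂ) (x : ℝ) : ℂ := g x + z * h x

/-- `G z x` is a polynomial in `z` whose coefficients are continuous functions of `x`. -/
def IsPolynomialFamily (G : ℂ → ℝ → ℂ) : Prop :=
  ∃ (N : ℕ) (c : ℕ → ℝ → ℂ), (∀ k, Continuous (c k)) ∧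
    ∀ z x, G z x = ∑ k ∈ Finset.range N, z ^ k * c k x

namespace IsPolynomialFamily

theorem differentiable {G : ℂ → ℝ → ℂ} (hG : IsPolynomialFamily G) (x : ℝ) :
    Differentiable ℂ fun z => G z x := by
  obtain ⟨N, c, -, h⟩ := hG
  simp only [h]
  fun_prop

theorem continuous {G : ℂ → ℝ → ℂ} (hG : IsPolynomialFamily G) (z : ℂ) : Continuous (G z) := by
  obtain ⟨N, c, hc, h⟩ := hG
  rw [funext (h z)]
  fun_prop

theorem const {w : ℝ → ℂ} (hw : Continuous w) : IsPolynomialFamily fun _ => w :=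
  ⟨1, fun _ => w, fun _ => hw, by simp⟩

theorem add {G H : ℂ → ℝ → ℂ} (hG : IsPolynomialFamily G) (hH : IsPolynomialFamily H) :
    IsPolynomialFamily fun z x => G z x + H z x := by
  obtain ⟨N, c, hc, h⟩ := hG
  obtain ⟨N', c', hc', h'⟩ := hH
  refine ⟨max N N', fun k x => (if k < N then c k x else 0) + (if k < N' then c' k x else 0),
    fun k => ?_, fun z x => ?_⟩
  · have := hc k
    have := hc' k
    dsimp only
    split_ifs <;> fun_prop
  · dsimp only
    rw [h, h']
    simp only [mul_add, Finset.sum_add_distrib, mul_ite, mul_zero, ← Finset.sum_filter]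
    congr 2 <;> ext k <;> simp +contextual

theorem mul_left {G : ℂ → ℝ → ℂ} (hG : IsPolynomialFamily G) :
    IsPolynomialFamily fun z x => z * G z x := by
  obtain ⟨N, c, hc, h⟩ := hG
  refine ⟨N + 1, fun k => if k = 0 then 0 else c (k - 1), fun k => ?_, fun z x => ?_⟩
  · by_cases hk : k = 0
    · simp only [hk, if_true]; exact continuous_const
    · simpa only [hk, if_false] using hc _
  · dsimp only
    rw [h, Finset.sum_range_succ', Finset.mul_sum]
    simp [pow_succ', mul_assoc]

theorem integral {G : ℂ → ℝ → ℂ} (hG : IsPolynomialFamily G) {q : ℝ → ℂ} {K : ℝ}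
    (hq : AEStronglyMeasurable q) (hK : ∀ x, ‖q x‖ ≤ K) :
    IsPolynomialFamily fun z x => ∫ t in (0 : ℝ)..x, q t * G z t := by
  obtain ⟨N, c, hc, h⟩ := hG
  refine ⟨N, fun k x => ∫ t in (0 : ℝ)..x, q t * c k t,
    fun k => continuous_integral_mul hq hK (hc k), fun z x => ?_⟩
  simp only [h, Finset.mul_sum, ← intervalIntegral.integral_const_mul]
  rw [intervalIntegral.integral_finsetSum]
  · refine Finset.sum_congr rfl fun k _ => intervalIntegral.integral_congr fun t _ => ?_
    ring
  · intro k _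
    exact intervalIntegrable_mul_of_continuous hq hK (continuous_const.mul (hc k)) _ _

end IsPolynomialFamily

section

variable {g h : ℝ → ℝ} {B C : ℝ}

theorem aestronglyMeasurable_affinePotential (hg : AEMeasurable g) (hh : AEMeasurable h) (z : ℂ) :
    AEStronglyMeasurable (affinePotential g h z) :=
  ((Complex.measurable_ofReal.comp_aemeasurable hg).add
    ((Complex.measurable_ofReal.comp_aemeasurable hh).const_mul z)).aestronglyMeasurable

theorem norm_affinePotential_le (hB : ∀ x, |g x| ≤ B) (hC : ∀ x, |h x| ≤ C) (z : ℂ) (x : ℝ) :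
    ‖affinePotential g h z x‖ ≤ B + ‖z‖ * C := by
  refine (norm_add_le _ _).trans (add_le_add ?_ ?_)
  · simpa using hB x
  · rw [norm_mul]
    exact mul_le_mul_of_nonneg_left (by simpa using hC x) (norm_nonneg _)

theorem IsPolynomialFamily.integral_affinePotential (hg : AEMeasurable g) (hh : AEMeasurable h)
    (hB : ∀ x, |g x| ≤ B) (hC : ∀ x, |h x| ≤ C) {G : ℂ → ℝ → ℂ} (hG : IsPolynomialFamily G) :
    IsPolynomialFamily fun z x => ∫ t in (0 : ℝ)..x, affinePotential g h z t * G z t := by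
  have hg' : AEStronglyMeasurable (fun x => (g x : ℂ)) :=
    (Complex.measurable_ofReal.comp_aemeasurable hg).aestronglyMeasurable
  have hh' : AEStronglyMeasurable (fun x => (h x : ℂ)) :=
    (Complex.measurable_ofReal.comp_aemeasurable hh).aestronglyMeasurable
  have hB' : ∀ x, ‖(g x : ℂ)‖ ≤ B := by simpa using hB
  have hC' : ∀ x, ‖(h x : ℂ)‖ ≤ C := by simpa using hC
  convert (hG.integral hg' hB').add (hG.integral hh' hC').mul_left using 3 with z x
  rw [← intervalIntegral.integral_const_mul, ← intervalIntegral.integral_add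
    (intervalIntegrable_mul_of_continuous hg' hB' (hG.continuous z) _ _)
    ((intervalIntegrable_mul_of_continuous hh' hC' (hG.continuous z) _ _).const_mul z)]
  refine intervalIntegral.integral_congr fun t _ => ?_
  simp only [affinePotential]
  ring

/-- The potential is affine in `z`, so each Picard iterate is a polynomial in `z`. Holomorphy of the
iterated integrals then needs no differentiation under the integral sign. -/
theorem isPolynomialFamily_volterraTerm (hg : AEMeasurable g) (hh : AEMeasurable h)
    (hB : ∀ x, |g x| ≤ B) (hC : ∀ x, |h x| ≤ C) (a b : ℂ) (n : ℕ) :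
    IsPolynomialFamily fun z => volterraTerm (affinePotential g h z) a b n := by
  induction n with
  | zero => exact IsPolynomialFamily.const (w := fun x => a + b * x) (by fun_prop)
  | succ n ih =>
    have := (ih.integral_affinePotential hg hh hB hC).integral (q := fun _ => 1) (K := 1)
      aestronglyMeasurable_const (by simp)
    simp only [one_mul] at this
    exact this

/-- Summable bounds on every ball make the convergence locally uniform, which preserves holomorphy.
-/
theorem differentiable_tsum_of_ball_bound {F : ℕ → ℂ → ℂ} {A k : ℝ → ℝ}
    (hF : ∀ n, Differentiable ℂ (F n))
    (hle : ∀ R : ℝ, ∀ n z, ‖z‖ < R → ‖F n z‖ ≤ A R * (k R ^ (2 * n) / (2 * n).factorial)) :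
    Differentiable ℂ fun z => ∑' n, F n z := by
  intro z
  have hz : z ∈ Metric.ball (0 : ℂ) (‖z‖ + 1) := by simp
  have := Complex.differentiableOn_tsum_of_summable_norm
    (hasSum_volterra_bound (A (‖z‖ + 1)) (k (‖z‖ + 1))).summable
    (fun n => (hF n).differentiableOn) Metric.isOpen_ball
    (fun n w (hw : w ∈ Metric.ball (0 : ℂ) (‖z‖ + 1)) =>
      hle (‖z‖ + 1) n w (by simpa using hw))
  exact this.differentiableAt (Metric.isOpen_ball.mem_nhds hz)

theorem norm_affinePotential_le_of_norm_lt (hB : ∀ x, |g x| ≤ B) (hC : ∀ x, |h x| ≤ C) {z : ℂ}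
    {R : ℝ} (hz : ‖z‖ < R) (x : ℝ) : ‖affinePotential g h z x‖ ≤ B + R * C :=
  (norm_affinePotential_le hB hC z x).trans <| by
    have : 0 ≤ C := (abs_nonneg _).trans (hC 0)
    gcongr

theorem differentiable_volterraSolution (hg : AEMeasurable g) (hh : AEMeasurable h)
    (hB : ∀ x, |g x| ≤ B) (hC : ∀ x, |h x| ≤ C) (a b : ℂ) {x : ℝ}
    (hx : x ∈ Set.Icc (0 : ℝ) 1) :
    Differentiable ℂ fun z => volterraSolution (affinePotential g h z) a b x :=
  differentiable_tsum_of_ball_bound (A := fun _ => ‖a‖ + ‖b‖) (k := fun R => √(B + R * C))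
    (fun n => (isPolynomialFamily_volterraTerm hg hh hB hC a b n).differentiable x)
    fun _ n _ hz => norm_volterraTerm_le' a b (norm_affinePotential_le_of_norm_lt hB hC hz) n hx

theorem differentiable_volterraDeriv (hg : AEMeasurable g) (hh : AEMeasurable h)
    (hB : ∀ x, |g x| ≤ B) (hC : ∀ x, |h x| ≤ C) (a b : ℂ) {x : ℝ}
    (hx : x ∈ Set.Icc (0 : ℝ) 1) :
    Differentiable ℂ fun z => volterraDeriv (affinePotential g h z) a b x := by
  refine (differentiable_const b).add ?_
  have : ∀ z, ∫ t in (0 : ℝ)..x,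
      affinePotential g h z t * volterraSolution (affinePotential g h z) a b t
      = ∑' n, ∫ t in (0 : ℝ)..x,
        affinePotential g h z t * volterraTerm (affinePotential g h z) a b n t := fun z =>
    (hasSum_integral_volterraTerm a b (aestronglyMeasurable_affinePotential hg hh z)
      (norm_affinePotential_le hB hC z) hx).tsum_eq.symm
  simp only [this]
  exact differentiable_tsum_of_ball_bound (A := fun R => (B + R * C) * (‖a‖ + ‖b‖))
    (k := fun R => √(B + R * C))
    (fun n => ((isPolynomialFamily_volterraTerm hg hh hB hC a b n).integral_affinePotential
      hg hh hB hC).differentiable x)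
    fun _ n _ hz =>
      norm_integral_volterraTerm_le a b (norm_affinePotential_le_of_norm_lt hB hC hz) n hx

/-- With `z = w ^ 2`, growth of order `1/2` in `z` becomes exponential type in `w`. -/
theorem cosh_sqrt_le (hB : 0 ≤ B) (hC : 0 ≤ C) (w : ℂ) :
    Real.cosh √(B + ‖w ^ 2‖ * C) ≤ Real.exp √B * Real.exp (√C * ‖w‖) := by
  have h1 : √(B + ‖w ^ 2‖ * C) ≤ √B + √C * ‖w‖ := by
    apply Real.sqrt_le_iff.2 ⟨by positivity, ?_⟩
    rw [norm_pow]
    have hb := Real.sq_sqrt hB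
    have hc := Real.sq_sqrt hC
    have : 0 ≤ √B * (√C * ‖w‖) := by positivity
    nlinarith
  rw [← Real.exp_add]
  refine le_trans ?_ (Real.exp_le_exp.2 h1)
  rw [Real.cosh_eq]
  have : Real.exp (-√(B + ‖w ^ 2‖ * C)) ≤ Real.exp √(B + ‖w ^ 2‖ * C) :=
    Real.exp_le_exp.2 (by linarith [Real.sqrt_nonneg (B + ‖w ^ 2‖ * C)])
  linarith

/-- The derivative carries an additional factor `K = B + ‖w‖² C`. It is quadratic in `‖w‖`, hence
absorbed by one more `exp ‖w‖`. -/
theorem sq_mul_cosh_sqrt_le (hB : 0 ≤ B) (hC : 0 ≤ C) (w : ℂ) :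
    (B + ‖w ^ 2‖ * C) * Real.cosh √(B + ‖w ^ 2‖ * C)
      ≤ 2 * (B + C) * Real.exp √B * Real.exp ((√C + 1) * ‖w‖) := by
  have h1 := cosh_sqrt_le hB hC w
  have h2 := Real.quadratic_le_exp_of_nonneg (norm_nonneg w)
  have hw := norm_nonneg w
  have h3 : B + ‖w ^ 2‖ * C ≤ 2 * (B + C) * Real.exp ‖w‖ := by
    rw [norm_pow]
    have : 1 ≤ Real.exp ‖w‖ := Real.one_le_exp hw
    nlinarith [mul_nonneg hB (sub_nonneg.2 this), mul_nonneg hC (sub_nonneg.2 h2)]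
  calc _ ≤ 2 * (B + C) * Real.exp ‖w‖ * (Real.exp √B * Real.exp (√C * ‖w‖)) := by
        apply mul_le_mul h3 h1 (by positivity) (by positivity)
    _ = _ := by rw [add_mul, Real.exp_add, one_mul]; ring

theorem norm_volterraSolution_sq_le (hB : ∀ x, |g x| ≤ B) (hC : ∀ x, |h x| ≤ C) (a b : ℂ)
    {x : ℝ} (hx : x ∈ Set.Icc (0 : ℝ) 1) (w : ℂ) :
    ‖volterraSolution (affinePotential g h (w ^ 2)) a b x‖
      ≤ ((‖a‖ + ‖b‖) * Real.exp √B) * Real.exp (√C * ‖w‖) := by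
  refine (norm_volterraSolution_le a b (norm_affinePotential_le hB hC (w ^ 2)) hx).trans ?_
  rw [mul_assoc]
  gcongr
  exact cosh_sqrt_le ((abs_nonneg _).trans (hB 0)) ((abs_nonneg _).trans (hC 0)) w

theorem norm_volterraDeriv_sq_le (hg : AEMeasurable g) (hh : AEMeasurable h)
    (hB : ∀ x, |g x| ≤ B) (hC : ∀ x, |h x| ≤ C) (a b : ℂ)
    {x : ℝ} (hx : x ∈ Set.Icc (0 : ℝ) 1) (w : ℂ) :
    ‖volterraDeriv (affinePotential g h (w ^ 2)) a b x‖
      ≤ (‖b‖ + (‖a‖ + ‖b‖) * (2 * (B + C) * Real.exp √B)) * Real.exp ((√C + 1) * ‖w‖) := by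
  refine (norm_add_le _ _).trans ?_
  rw [add_mul]
  apply add_le_add
  · exact le_mul_of_one_le_right (norm_nonneg _) (Real.one_le_exp (by positivity))
  · refine (norm_integral_volterraSolution_le a b
      (aestronglyMeasurable_affinePotential hg hh _)
      (norm_affinePotential_le hB hC (w ^ 2)) hx).trans ?_
    rw [mul_comm _ (‖a‖ + ‖b‖), mul_assoc (‖a‖ + ‖b‖), mul_assoc (‖a‖ + ‖b‖)]
    refine mul_le_mul_of_nonneg_left ?_ (by positivity)
    exact sq_mul_cosh_sqrt_le ((abs_nonneg _).trans (hB 0)) ((abs_nonneg _).trans (hC 0)) w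

end

/-! ### Phragmén–Lindelöf for order at most `1/2`. -/

/-- An entire function of order at most `1/2` which is bounded on the real line is constant. -/
theorem apply_eq_apply_of_bounded_on_real_of_exp_sqrt {F : ℂ → ℂ} (hF : Differentiable ℂ F)
    {A k M : ℝ} (hgrowth : ∀ w, ‖F (w ^ 2)‖ ≤ A * Real.exp (k * ‖w‖))
    (hM : ∀ x : ℝ, ‖F x‖ ≤ M) (z w : ℂ) : F z = F w := by
  -- Squaring maps both coordinate axes into the real line, so `G` is bounded on the boundary of
  -- each quadrant. A quadrant has opening `π/2` and tolerates growth `exp (B ‖z‖ ^ c)` with `c <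
  -- 2`; here `c = 1`.
  set G : ℂ → ℂ := fun w => F (w ^ 2) with hG
  have hGd : Differentiable ℂ G := hF.comp (by fun_prop)
  have hre : ∀ x : ℝ, ‖G x‖ ≤ M := fun x => by
    have h : (x : ℂ) ^ 2 = ((x ^ 2 : ℝ) : ℂ) := by simp
    simpa only [hG, h] using hM (x ^ 2)
  have him : ∀ x : ℝ, ‖G (x * Complex.I)‖ ≤ M := fun x => by
    have h : ((x : ℂ) * Complex.I) ^ 2 = ((-x ^ 2 : ℝ) : ℂ) := by simp [mul_pow]
    simpa only [hG, h] using hM (-x ^ 2)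
  have hO : ∀ l : Filter ℂ, ∃ c < (2 : ℝ), ∃ B, G =O[l] fun z => Real.exp (B * ‖z‖ ^ c) := by
    intro l
    refine ⟨1, by norm_num, k, Asymptotics.IsBigO.of_bound A (Filter.Eventually.of_forall ?_)⟩
    intro z
    simpa [Real.norm_eq_abs] using hgrowth z
  have hbd : ∀ z, ‖G z‖ ≤ M := by
    intro z
    rcases le_total 0 z.re with h1 | h1 <;> rcases le_total 0 z.im with h2 | h2
    · exact PhragmenLindelof.quadrant_I hGd.diffContOnCl (hO _) (fun x _ => hre x)
        (fun x _ => him x) h1 h2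
    · exact PhragmenLindelof.quadrant_IV hGd.diffContOnCl (hO _) (fun x _ => hre x)
        (fun x _ => him x) h1 h2
    · exact PhragmenLindelof.quadrant_II hGd.diffContOnCl (hO _) (fun x _ => hre x)
        (fun x _ => him x) h1 h2
    · exact PhragmenLindelof.quadrant_III hGd.diffContOnCl (hO _) (fun x _ => hre x)
        (fun x _ => him x) h1 h2
  obtain ⟨z', rfl⟩ := IsAlgClosed.exists_pow_nat_eq z two_pos
  obtain ⟨w', rfl⟩ := IsAlgClosed.exists_pow_nat_eq w two_pos
  -- Liouville for `G`; every complex number is a square, so `F` is constant too.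
  refine hGd.apply_eq_apply_of_bounded ?_ z' w'
  rw [isBounded_iff_forall_norm_le]
  exact ⟨M, by rintro _ ⟨z, rfl⟩; exact hbd z⟩

/-! ### Absolutely continuous solutions: representation, existence, Wronskians. -/

namespace IsSolutionOnUnitInterval

section

variable {q u p : ℝ → ℝ}

theorem ac_u_mono (hs : IsSolutionOnUnitInterval q u p) {x : ℝ} (hx : x ∈ Set.Icc (0 : ℝ) 1) : AbsolutelyContinuousOnInterval u 0 x :=
  hs.ac_u.mono (by rw [Set.uIcc_of_le hx.1, Set.uIcc_of_le zero_le_one]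
                   exact Set.Icc_subset_Icc_right hx.2)

theorem ac_p_mono (hs : IsSolutionOnUnitInterval q u p) {x : ℝ} (hx : x ∈ Set.Icc (0 : ℝ) 1) : AbsolutelyContinuousOnInterval p 0 x :=
  hs.ac_p.mono (by rw [Set.uIcc_of_le hx.1, Set.uIcc_of_le zero_le_one]
                   exact Set.Icc_subset_Icc_right hx.2)

theorem continuousOn_u (hs : IsSolutionOnUnitInterval q u p) : ContinuousOn u (Set.Icc 0 1) := by
  simpa [Set.uIcc_of_le] using hs.ac_u.continuousOn

theorem u_eq_integral (hs : IsSolutionOnUnitInterval q u p) {x : ℝ} (hx : x ∈ Set.Icc (0 : ℝ) 1) :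
    u x = u 0 + ∫ s in (0 : ℝ)..x, p s := by
  have h : ∫ s in (0 : ℝ)..x, p s = ∫ s in (0 : ℝ)..x, deriv u s := by
    apply intervalIntegral.integral_congr_ae
    filter_upwards [hs.deriv_u] with s hs' hsx
    rw [Set.uIoc_of_le hx.1] at hsx
    exact (hs' ⟨hsx.1.le, hsx.2.trans hx.2⟩).deriv.symm
  rw [h, (hs.ac_u_mono hx).integral_deriv_eq_sub]
  ring

theorem p_eq_integral (hs : IsSolutionOnUnitInterval q u p) {x : ℝ} (hx : x ∈ Set.Icc (0 : ℝ) 1) :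
    p x = p 0 + ∫ s in (0 : ℝ)..x, q s * u s := by
  have h : ∫ s in (0 : ℝ)..x, q s * u s = ∫ s in (0 : ℝ)..x, deriv p s := by
    apply intervalIntegral.integral_congr_ae
    filter_upwards [hs.deriv_p] with s hs' hsx
    rw [Set.uIoc_of_le hx.1] at hsx
    exact (hs' ⟨hsx.1.le, hsx.2.trans hx.2⟩).deriv.symm
  rw [h, (hs.ac_p_mono hx).integral_deriv_eq_sub]
  ring

theorem u_eq_double_integral (hs : IsSolutionOnUnitInterval q u p) {x : ℝ} (hx : x ∈ Set.Icc (0 : ℝ) 1) :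
    u x = u 0 + p 0 * x + ∫ s in (0 : ℝ)..x, ∫ t in (0 : ℝ)..s, q t * u t := by
  have h : ∫ s in (0 : ℝ)..x, ∫ t in (0 : ℝ)..s, q t * u t = ∫ s in (0 : ℝ)..x, (p s - p 0) := by
    apply intervalIntegral.integral_congr
    intro s hsx
    rw [Set.uIcc_of_le hx.1] at hsx
    dsimp only
    rw [hs.p_eq_integral ⟨hsx.1, hsx.2.trans hx.2⟩]
    ring
  rw [h, intervalIntegral.integral_sub (hs.ac_p_mono hx).continuousOn.intervalIntegrable
    (continuous_const.intervalIntegrable _ _), hs.u_eq_integral hx]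
  simp
  ring

/-- A solution is given by the Volterra series. -/
theorem u_eq_volterraSolution (hs : IsSolutionOnUnitInterval q u p) {K : ℝ} (hq : AEMeasurable q) (hK : ∀ x, |q x| ≤ K) {x : ℝ}
    (hx : x ∈ Set.Icc (0 : ℝ) 1) :
    (u x : ℂ) = volterraSolution (fun x => (q x : ℂ)) (u 0) (p 0) x := by
  have hq' : AEStronglyMeasurable (fun x => (q x : ℂ)) :=
    (Complex.measurable_ofReal.comp_aemeasurable hq).aestronglyMeasurable
  have hK' : ∀ x, ‖(q x : ℂ)‖ ≤ K := by simpa using hK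
  have hcu : ContinuousOn (fun x => (u x : ℂ)) (Set.Icc 0 1) :=
    Complex.continuous_ofReal.comp_continuousOn hs.continuousOn_u
  have hcv := continuousOn_volterraSolution (u 0 : ℂ) (p 0) hq' hK'
  refine sub_eq_zero.1 (eq_zero_of_volterra (q := fun x => (q x : ℂ))
    (w := fun x => (u x : ℂ) - volterraSolution (fun x => (q x : ℂ)) (u 0) (p 0) x)
    hK' (hcu.sub hcv) (fun x hx => ?_) hx)
  have hint : ∀ w : ℝ → ℂ, ContinuousOn w (Set.Icc 0 1) →
      IntervalIntegrable (fun s => ∫ t in (0 : ℝ)..s, (q t : ℂ) * w t) volume 0 x := by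
    intro w hw
    apply ContinuousOn.intervalIntegrable
    apply intervalIntegral.continuousOn_primitive_interval
    have := (intervalIntegrable_mul_of_continuousOn hq' hK' hw hx)
    rwa [intervalIntegrable_iff'] at this
  have hsub : ∫ s in (0 : ℝ)..x, ∫ t in (0 : ℝ)..s, (q t : ℂ) *
        ((u t : ℂ) - volterraSolution (fun x => (q x : ℂ)) (u 0) (p 0) t)
      = ∫ s in (0 : ℝ)..x, ((∫ t in (0 : ℝ)..s, (q t : ℂ) * u t) -
        ∫ t in (0 : ℝ)..s, (q t : ℂ) * volterraSolution (fun x => (q x : ℂ)) (u 0) (p 0) t) := by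
    apply intervalIntegral.integral_congr
    intro s hsx
    rw [Set.uIcc_of_le hx.1] at hsx
    have hs1 : s ∈ Set.Icc (0 : ℝ) 1 := ⟨hsx.1, hsx.2.trans hx.2⟩
    dsimp only
    rw [← intervalIntegral.integral_sub (intervalIntegrable_mul_of_continuousOn hq' hK' hcu hs1)
      (intervalIntegrable_mul_of_continuousOn hq' hK' hcv hs1)]
    simp only [mul_sub]
  rw [hsub, intervalIntegral.integral_sub (hint _ hcu) (hint _ hcv),
    volterraSolution_eq (u 0 : ℂ) (p 0) hq' hK' hx, hs.u_eq_double_integral hx]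
  push_cast [← intervalIntegral.integral_ofReal]
  ring

theorem p_eq_volterraDeriv (hs : IsSolutionOnUnitInterval q u p) {K : ℝ} (hq : AEMeasurable q) (hK : ∀ x, |q x| ≤ K) {x : ℝ}
    (hx : x ∈ Set.Icc (0 : ℝ) 1) :
    (p x : ℂ) = volterraDeriv (fun x => (q x : ℂ)) (u 0) (p 0) x := by
  rw [hs.p_eq_integral hx, volterraDeriv]
  push_cast [← intervalIntegral.integral_ofReal]
  congr 1
  apply intervalIntegral.integral_congr
  intro s hsx
  rw [Set.uIcc_of_le hx.1] at hsx
  dsimp only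
  rw [hs.u_eq_volterraSolution hq hK ⟨hsx.1, hsx.2.trans hx.2⟩]

end

theorem exists_solution {q : ℝ → ℝ} {K : ℝ} (hq : AEMeasurable q) (hK : ∀ x, |q x| ≤ K)
    (a b : ℝ) : ∃ u p, IsSolutionOnUnitInterval q u p ∧ u 0 = a ∧ p 0 = b := by
  have hq' : AEStronglyMeasurable (fun x => (q x : ℂ)) :=
    (Complex.measurable_ofReal.comp_aemeasurable hq).aestronglyMeasurable
  have hK' : ∀ x, ‖(q x : ℂ)‖ ≤ K := by simpa using hK
  set v := volterraSolution (fun x => (q x : ℂ)) a b with hv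
  have hcv : ContinuousOn v (Set.Icc 0 1) := continuousOn_volterraSolution (a : ℂ) b hq' hK'
  have hcr : ContinuousOn (fun x => (v x).re) (Set.Icc 0 1) :=
    Complex.continuous_re.comp_continuousOn hcv
  have hqv : IntervalIntegrable (fun t => q t * (v t).re) volume 0 1 := by
    refine IntervalIntegrable.bounded_mul ?_ hq.aestronglyMeasurable hK
    apply ContinuousOn.intervalIntegrable
    rwa [Set.uIcc_of_le zero_le_one]
  set p : ℝ → ℝ := fun x => b + ∫ t in (0 : ℝ)..x, q t * (v t).re with hp
  have hac : AbsolutelyContinuousOnInterval p 0 1 := by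
    have h := hqv.absolutelyContinuousOnInterval_intervalIntegral (c := 0) (by simp)
    have hconst : AbsolutelyContinuousOnInterval (fun _ : ℝ => b) 0 1 :=
      (LipschitzWith.const b).lipschitzOnWith.absolutelyContinuousOnInterval
    exact hconst.add h
  have hpi : IntervalIntegrable p volume 0 1 := hac.continuousOn.intervalIntegrable
  have huv : ∀ x ∈ Set.Icc (0 : ℝ) 1, a + ∫ t in (0 : ℝ)..x, p t = (v x).re := by
    intro x hx
    have hint : IntervalIntegrable (fun s => ∫ t in (0 : ℝ)..s, (q t : ℂ) * v t) volume 0 x := by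
      apply ContinuousOn.intervalIntegrable
      apply intervalIntegral.continuousOn_primitive_interval
      have := (intervalIntegrable_mul_of_continuousOn hq' hK' hcv hx)
      rwa [intervalIntegrable_iff'] at this
    rw [hv, volterraSolution_eq (a : ℂ) b hq' hK' hx, ← hv, Complex.add_re,
      ← Complex.reCLM_apply (∫ s in (0 : ℝ)..x, _),
      ← Complex.reCLM.intervalIntegral_comp_comm hint]
    have : ∀ s ∈ Set.uIcc 0 x, p s - b
        = Complex.reCLM (∫ t in (0 : ℝ)..s, (q t : ℂ) * v t) := by
      intro s hsx
      rw [Set.uIcc_of_le hx.1] at hsx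
      have hs1 : s ∈ Set.Icc (0 : ℝ) 1 := ⟨hsx.1, hsx.2.trans hx.2⟩
      rw [← Complex.reCLM.intervalIntegral_comp_comm
        (intervalIntegrable_mul_of_continuousOn hq' hK' hcv hs1)]
      simp [hp]
    rw [← intervalIntegral.integral_congr this, intervalIntegral.integral_sub _
      (continuous_const.intervalIntegrable _ _)]
    · simp
      ring
    · exact hpi.mono_set (by
        rw [Set.uIcc_of_le hx.1, Set.uIcc_of_le zero_le_one]
        exact Set.Icc_subset_Icc_right hx.2)
  -- The solution is taken as a primitive of `p`, not as the real part of `v`: this gives absolute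
  -- continuity and the a.e. two-sided derivative at once, while `huv` identifies the two on
  -- `[0,1]`.
  refine ⟨fun x => a + ∫ t in (0 : ℝ)..x, p t, p, ⟨?_, hac, ?_, ?_⟩, by simp, by simp [hp]⟩
  · have h := hpi.absolutelyContinuousOnInterval_intervalIntegral (c := 0) (by simp)
    have hconst : AbsolutelyContinuousOnInterval (fun _ : ℝ => a) 0 1 :=
      (LipschitzWith.const a).lipschitzOnWith.absolutelyContinuousOnInterval
    exact hconst.add h
  · filter_upwards [hpi.ae_hasDerivAt_integral] with x hx hx1
    rw [Set.uIcc_of_le zero_le_one] at hx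
    exact (hx hx1 0 (by simp)).const_add a
  · filter_upwards [hqv.ae_hasDerivAt_integral] with x hx hx1
    rw [Set.uIcc_of_le zero_le_one] at hx
    rw [huv x hx1]
    exact (hx hx1 0 (by simp)).const_add b

theorem linear_combination {q u₁ p₁ u₂ p₂ : ℝ → ℝ} (h₁ : IsSolutionOnUnitInterval q u₁ p₁)
    (h₂ : IsSolutionOnUnitInterval q u₂ p₂) (a b : ℝ) :
    IsSolutionOnUnitInterval q (fun x => a * u₁ x + b * u₂ x)
      (fun x => a * p₁ x + b * p₂ x) where
  ac_u := (h₁.ac_u.const_mul a).add (h₂.ac_u.const_mul b)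
  ac_p := (h₁.ac_p.const_mul a).add (h₂.ac_p.const_mul b)
  deriv_u := by
    filter_upwards [h₁.deriv_u, h₂.deriv_u] with x hx₁ hx₂ hx
    exact ((hx₁ hx).const_mul a).add ((hx₂ hx).const_mul b)
  deriv_p := by
    filter_upwards [h₁.deriv_p, h₂.deriv_p] with x hx₁ hx₂ hx
    exact (((hx₁ hx).const_mul a).add ((hx₂ hx).const_mul b)).congr_deriv (by ring)

/-- The derivative of the Wronskian is `(q₂ - q₁) u₁ u₂` almost everywhere. Equal potentials give
determinant `1` and unique continuation; different couplings give the motion of lines. -/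
theorem wronskian_sub_eq_integral {q₁ q₂ u₁ p₁ u₂ p₂ : ℝ → ℝ}
    (h₁ : IsSolutionOnUnitInterval q₁ u₁ p₁) (h₂ : IsSolutionOnUnitInterval q₂ u₂ p₂)
    {x : ℝ} (hx : x ∈ Set.Icc (0 : ℝ) 1) :
    (u₁ x * p₂ x - p₁ x * u₂ x) - (u₁ 0 * p₂ 0 - p₁ 0 * u₂ 0)
      = ∫ t in (0 : ℝ)..x, (q₂ t - q₁ t) * (u₁ t * u₂ t) := by
  have hac : AbsolutelyContinuousOnInterval (fun x => u₁ x * p₂ x - p₁ x * u₂ x) 0 x :=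
    ((h₁.ac_u_mono hx).mul (h₂.ac_p_mono hx)).sub ((h₁.ac_p_mono hx).mul (h₂.ac_u_mono hx))
  rw [← hac.integral_deriv_eq_sub]
  apply intervalIntegral.integral_congr_ae
  filter_upwards [h₁.deriv_u, h₂.deriv_u, h₁.deriv_p, h₂.deriv_p] with t hu₁ hu₂ hp₁ hp₂ ht
  rw [Set.uIoc_of_le hx.1] at ht
  have ht1 : t ∈ Set.Icc (0 : ℝ) 1 := ⟨ht.1.le, ht.2.trans hx.2⟩
  exact ((((hu₁ ht1).mul (hp₂ ht1)).sub ((hp₁ ht1).mul (hu₂ ht1))).congr_deriv (by ring)).deriv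

theorem wronskian_eq {q u₁ p₁ u₂ p₂ : ℝ → ℝ}
    (h₁ : IsSolutionOnUnitInterval q u₁ p₁) (h₂ : IsSolutionOnUnitInterval q u₂ p₂)
    {x : ℝ} (hx : x ∈ Set.Icc (0 : ℝ) 1) :
    u₁ x * p₂ x - p₁ x * u₂ x = u₁ 0 * p₂ 0 - p₁ 0 * u₂ 0 := by
  have := wronskian_sub_eq_integral h₁ h₂ hx
  simpa [sub_eq_zero] using this

end IsSolutionOnUnitInterval

/-! ### Transfer matrices. -/

/-- The transfer matrix from `0` to `1` of `u'' = q u` for a complex potential `q`. -/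
noncomputable def complexTransferMatrix (q : ℝ → ℂ) : Matrix (Fin 2) (Fin 2) ℂ :=
  !![volterraSolution q 1 0 1, volterraSolution q 0 1 1;
     volterraDeriv q 1 0 1, volterraDeriv q 0 1 1]

/-- For a real potential there is a real transfer matrix, which lies in `SL(2,ℝ)`. -/
theorem exists_isTransferMatrix {q : ℝ → ℝ} {K : ℝ} (hq : AEMeasurable q)
    (hK : ∀ x, |q x| ≤ K) :
    ∃ T : SpecialLinearGroup (Fin 2) ℝ, IsTransferMatrix q T ∧
      (T : Matrix (Fin 2) (Fin 2) ℝ).map Complex.ofReal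
        = complexTransferMatrix fun x => (q x : ℂ) := by
  obtain ⟨u₁, p₁, h₁, hu₁, hp₁⟩ := IsSolutionOnUnitInterval.exists_solution hq hK 1 0
  obtain ⟨u₂, p₂, h₂, hu₂, hp₂⟩ := IsSolutionOnUnitInterval.exists_solution hq hK 0 1
  have h01 : (1 : ℝ) ∈ Set.Icc (0 : ℝ) 1 := by simp
  -- The determinant is the Wronskian of the fundamental solutions at `1`, which equals its value
  -- `1` at `0`.
  have hdet : (!![u₁ 1, u₂ 1; p₁ 1, p₂ 1] : Matrix (Fin 2) (Fin 2) ℝ).det = 1 := by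
    have := h₁.wronskian_eq h₂ h01
    rw [hu₁, hu₂, hp₁, hp₂] at this
    rw [Matrix.det_fin_two_of]
    linarith
  refine ⟨⟨_, hdet⟩, fun v w => ?_, ?_⟩
  · have hcomb := h₁.linear_combination h₂ (v 0) (v 1)
    have hT : !![u₁ 1, u₂ 1; p₁ 1, p₂ 1] *ᵥ v
        = ![v 0 * u₁ 1 + v 1 * u₂ 1, v 0 * p₁ 1 + v 1 * p₂ 1] := by
      ext i
      fin_cases i <;> simp [Matrix.mulVec, dotProduct, Fin.sum_univ_two] <;> ring
    constructor
    · rintro ⟨u, p, hs, rfl, rfl⟩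
      have e1 := hs.u_eq_volterraSolution hq hK h01
      have e2 := hs.p_eq_volterraDeriv hq hK h01
      have e3 := hcomb.u_eq_volterraSolution hq hK h01
      have e4 := hcomb.p_eq_volterraDeriv hq hK h01
      simp only [hu₁, hu₂, hp₁, hp₂, Matrix.cons_val_zero, Matrix.cons_val_one, mul_one, mul_zero,
        add_zero, zero_add] at e3 e4
      rw [← e1, Complex.ofReal_inj] at e3
      rw [← e2, Complex.ofReal_inj] at e4
      change !![u₁ 1, u₂ 1; p₁ 1, p₂ 1] *ᵥ _ = _
      rw [hT]
      simp only [Matrix.cons_val_zero, Matrix.cons_val_one, e3, e4]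
    · rintro rfl
      refine ⟨_, _, hcomb, ?_, hT.symm⟩
      ext i
      fin_cases i <;> simp [hu₁, hu₂, hp₁, hp₂]
  · have e1 := h₁.u_eq_volterraSolution hq hK h01
    have e2 := h₁.p_eq_volterraDeriv hq hK h01
    have e3 := h₂.u_eq_volterraSolution hq hK h01
    have e4 := h₂.p_eq_volterraDeriv hq hK h01
    simp only [hu₁, hu₂, hp₁, hp₂, Complex.ofReal_one, Complex.ofReal_zero] at e1 e2 e3 e4
    ext i j
    fin_cases i <;> fin_cases j <;> simp [complexTransferMatrix, e1, e2, e3, e4]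

/-! ### Motion of lines and strong irreducibility. -/

section

open Filter Topology

/-- The Wronskian with a solution of arbitrary data `(a, b)` is constant and vanishes at `x`;
evaluating it at `0` for two independent choices of data gives the claim. -/
theorem IsSolutionOnUnitInterval.eq_zero_of_vanish {q u p : ℝ → ℝ} {K : ℝ}
    (hs : IsSolutionOnUnitInterval q u p) (hq : AEMeasurable q) (hK : ∀ x, |q x| ≤ K)
    {x : ℝ} (hx : x ∈ Set.Icc (0 : ℝ) 1) (hu : u x = 0) (hp : p x = 0) : u 0 = 0 ∧ p 0 = 0 := by
  have key : ∀ a b : ℝ, u 0 * b - p 0 * a = 0 := by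
    intro a b
    obtain ⟨u₂, p₂, h₂, rfl, rfl⟩ := IsSolutionOnUnitInterval.exists_solution hq hK a b
    rw [← hs.wronskian_eq h₂ hx, hu, hp]
    ring
  have h1 := key 0 1
  have h2 := key 1 0
  constructor <;> linarith

/-- A solution whose square has vanishing integral against a weight positive on an interval has
vanishing initial data. -/
theorem IsSolutionOnUnitInterval.eq_zero_of_integral_eq_zero {q u p h : ℝ → ℝ} {K C α β : ℝ}
    (hs : IsSolutionOnUnitInterval q u p) (hq : AEMeasurable q) (hK : ∀ x, |q x| ≤ K)
    (hh : AEMeasurable h) (hC : ∀ x, |h x| ≤ C) (hh0 : ∀ x, 0 ≤ h x) (hαβ : α < β)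
    (hsub : Set.Ioo α β ⊆ Set.Icc 0 1) (hpos : ∀ x ∈ Set.Ioo α β, 0 < h x)
    (hint : ∫ t in (0 : ℝ)..1, h t * (u t * u t) = 0) : u 0 = 0 ∧ p 0 = 0 := by
  have hii : IntervalIntegrable (fun t => h t * (u t * u t)) volume 0 1 := by
    refine IntervalIntegrable.bounded_mul ?_ hh.aestronglyMeasurable hC
    apply ContinuousOn.intervalIntegrable
    rw [Set.uIcc_of_le zero_le_one]
    exact hs.continuousOn_u.mul hs.continuousOn_u
  rw [intervalIntegral.integral_eq_zero_iff_of_le_of_nonneg_ae zero_le_one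
    (by filter_upwards with t using mul_nonneg (hh0 t) (mul_self_nonneg _)) hii,
    Filter.EventuallyEq, ae_restrict_iff' measurableSet_Ioc] at hint
  have h0 : ∀ᵐ x : ℝ, x ≠ 0 := by simp [ae_iff]
  have hzero : Set.EqOn u 0 (Set.Ioo α β) := by
    refine Measure.eqOn_open_of_ae_eq (μ := volume) ?_ isOpen_Ioo
      (hs.continuousOn_u.mono hsub) continuousOn_const
    rw [Filter.EventuallyEq, ae_restrict_iff' measurableSet_Ioo]
    filter_upwards [hint, h0] with x hx hx0 hxI
    have h01 := hsub hxI
    have := hx ⟨lt_of_le_of_ne h01.1 hx0.symm, h01.2⟩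
    simpa [(hpos x hxI).ne'] using this
  -- The relation `u' = p` is only known almost everywhere, so a point of the interval where it
  -- holds is picked; there `u` is locally zero and hence `p` vanishes as well.
  have hex : ∃ x ∈ Set.Ioo α β, HasDerivAt u (p x) x := by
    have hne : (ae (volume.restrict (Set.Ioo α β))).NeBot := by
      rw [ae_neBot, Ne, Measure.restrict_eq_zero, Real.volume_Ioo]
      simpa using hαβ
    have h1 : ∀ᵐ x ∂(volume.restrict (Set.Ioo α β)), x ∈ Set.Ioo α β :=
      ae_restrict_mem measurableSet_Ioo
    obtain ⟨x, hx, hx'⟩ := (h1.and (ae_restrict_of_ae hs.deriv_u)).exists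
    exact ⟨x, hx, hx' (hsub hx)⟩
  obtain ⟨x, hx, hd⟩ := hex
  refine hs.eq_zero_of_vanish hq hK (hsub hx) (hzero hx) ?_
  have : u =ᶠ[𝓝 x] fun _ => 0 := by
    filter_upwards [isOpen_Ioo.mem_nhds hx] with y hy using hzero hy
  exact hd.unique ((hasDerivAt_const x (0 : ℝ)).congr_of_eventuallyEq this)

variable {g h : ℝ → ℝ} {B C : ℝ} {T : ℝ → SpecialLinearGroup (Fin 2) ℝ}

theorem ofReal_affine_eq_affinePotential (g h : ℝ → ℝ) (η : ℝ) :
    (fun x => ((g x + η * h x : ℝ) : ℂ)) = affinePotential g h η := by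
  ext x
  simp [affinePotential]

theorem abs_affine_le (hB : ∀ x, |g x| ≤ B) (hC : ∀ x, |h x| ≤ C) (η x : ℝ) :
    |g x + η * h x| ≤ B + |η| * C := by
  have := norm_affinePotential_le hB hC (η : ℂ) x
  rw [← ofReal_affine_eq_affinePotential, Complex.norm_real, Complex.norm_real] at this
  exact this

/-- The direction of the solution at `1` with fixed initial data at `0` is locally injective in the
coupling constant. -/
theorem eventually_transfer_not_parallel (hg : AEMeasurable g) (hh : AEMeasurable h)
    (hB : ∀ x, |g x| ≤ B) (hC : ∀ x, |h x| ≤ C) (hh0 : ∀ x, 0 ≤ h x) {α β : ℝ} (hαβ : α < β)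
    (hsub : Set.Ioo α β ⊆ Set.Icc 0 1) (hpos : ∀ x ∈ Set.Ioo α β, 0 < h x)
    (hT : ∀ η, IsTransferMatrix (fun x => g x + η * h x) (T η))
    {v : Fin 2 → ℝ} (hv : v ≠ 0) (η₀ : ℝ) :
    ∀ᶠ η in 𝓝[≠] η₀,
      ((T η : Matrix (Fin 2) (Fin 2) ℝ) *ᵥ v) 0 * ((T η₀ : Matrix (Fin 2) (Fin 2) ℝ) *ᵥ v) 1 -
      ((T η : Matrix (Fin 2) (Fin 2) ℝ) *ᵥ v) 1 * ((T η₀ : Matrix (Fin 2) (Fin 2) ℝ) *ᵥ v) 0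
        ≠ 0 := by
  have hsol := fun η => (hT η v _).2 rfl
  choose u p hs hinit hend using hsol
  have hu0 : ∀ η, u η 0 = v 0 := fun η => congrFun (hinit η) 0
  have hp0 : ∀ η, p η 0 = v 1 := fun η => congrFun (hinit η) 1
  have hC0 : 0 ≤ C := (abs_nonneg _).trans (hC 0)
  have h01 : (1 : ℝ) ∈ Set.Icc (0 : ℝ) 1 := by simp
  have hqm : ∀ η : ℝ, AEMeasurable fun x => g x + η * h x := fun η => hg.add (hh.const_mul η)
  have hmem : ∀ x ∈ Set.uIoc (0 : ℝ) 1, x ∈ Set.Icc (0 : ℝ) 1 := by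
    intro x hx
    rw [Set.uIoc_of_le zero_le_one] at hx
    exact ⟨hx.1.le, hx.2⟩
  have huv : ∀ η, ∀ x ∈ Set.Icc (0 : ℝ) 1,
      (u η x : ℂ) = volterraSolution (affinePotential g h η) (v 0) (v 1) x := by
    intro η x hx
    have := (hs η).u_eq_volterraSolution (hqm η) (abs_affine_le hB hC η) hx
    rwa [ofReal_affine_eq_affinePotential, hu0, hp0] at this
  have hcont : ∀ x ∈ Set.Icc (0 : ℝ) 1, Continuous fun η => u η x := by
    intro x hx
    have h1 : (fun η => u η x)
        = fun η : ℝ => (volterraSolution (affinePotential g h η) (v 0) (v 1) x).re := by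
      ext η
      rw [← huv η x hx, Complex.ofReal_re]
    rw [h1]
    exact Complex.continuous_re.comp
      ((differentiable_volterraSolution hg hh hB hC _ _ hx).continuous.comp
        Complex.continuous_ofReal)
  set D := (‖(v 0 : ℂ)‖ + ‖(v 1 : ℂ)‖) * Real.cosh √(B + (|η₀| + 1) * C) with hD
  have hbound : ∀ η, |η| < |η₀| + 1 → ∀ x ∈ Set.Icc (0 : ℝ) 1, |u η x| ≤ D := by
    intro η hη x hx
    have h1 := norm_volterraSolution_le (v 0 : ℂ) (v 1)
      (norm_affinePotential_le_of_norm_lt hB hC (z := (η : ℂ)) (R := |η₀| + 1) (by simpa using hη))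
      hx
    rwa [← huv η x hx, Complex.norm_real] at h1
  have hD0 : 0 ≤ D := by positivity
  -- Dominated convergence: `u η` depends continuously on `η` pointwise and is bounded by `D` for
  -- `η` near `η₀`.
  have hlim : Tendsto (fun η => ∫ t in (0 : ℝ)..1, h t * (u η t * u η₀ t)) (𝓝 η₀)
      (𝓝 (∫ t in (0 : ℝ)..1, h t * (u η₀ t * u η₀ t))) := by
    refine intervalIntegral.tendsto_integral_filter_of_dominated_convergence
      (fun _ => C * (D * D)) ?_ ?_ ?_ ?_
    · filter_upwards with η
      rw [Set.uIoc_of_le zero_le_one]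
      exact hh.aestronglyMeasurable.restrict.mul
        ((((hs η).continuousOn_u.mul (hs η₀).continuousOn_u).mono
          Set.Ioc_subset_Icc_self).aestronglyMeasurable measurableSet_Ioc)
    · have : ∀ᶠ η in 𝓝 η₀, |η| < |η₀| + 1 :=
        continuous_abs.continuousAt.eventually_lt continuousAt_const (by simp)
      filter_upwards [this] with η hη
      filter_upwards with x hx
      rw [Real.norm_eq_abs, abs_mul, abs_mul]
      have h1 := hbound η hη x (hmem x hx)
      have h2 := hbound η₀ (by simp) x (hmem x hx)
      have h3 := hC x
      gcongr
    · exact continuous_const.intervalIntegrable _ _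
    · filter_upwards with x hx
      exact (((hcont x (hmem x hx)).tendsto η₀).mul_const _).const_mul _
  have hne : ∫ t in (0 : ℝ)..1, h t * (u η₀ t * u η₀ t) ≠ 0 := by
    intro h0
    obtain ⟨h1, h2⟩ := (hs η₀).eq_zero_of_integral_eq_zero (hqm η₀) (abs_affine_le hB hC η₀) hh hC
      hh0 hαβ hsub hpos h0
    apply hv
    ext i
    fin_cases i
    · simpa [hu0] using h1
    · simpa [hp0] using h2
  have hev := (hlim.eventually_ne hne).filter_mono (nhdsWithin_le_nhds (s := {η₀}ᶜ))
  filter_upwards [hev, self_mem_nhdsWithin] with η hη hηne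
  have hw := (hs η).wronskian_sub_eq_integral (hs η₀) h01
  have he : ∀ η, ((T η : Matrix (Fin 2) (Fin 2) ℝ) *ᵥ v) 0 = u η 1 ∧
      ((T η : Matrix (Fin 2) (Fin 2) ℝ) *ᵥ v) 1 = p η 1 := fun η => by
    rw [← hend η]; simp
  rw [(he η).1, (he η).2, (he η₀).1, (he η₀).2]
  have hi : ∫ t in (0 : ℝ)..1, (g t + η₀ * h t - (g t + η * h t)) * (u η t * u η₀ t)
      = (η₀ - η) * ∫ t in (0 : ℝ)..1, h t * (u η t * u η₀ t) := by
    rw [← intervalIntegral.integral_const_mul]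
    refine intervalIntegral.integral_congr fun t _ => ?_
    ring
  rw [hi, hu0, hu0, hp0, hp0] at hw
  have h3 : u η 1 * p η₀ 1 - p η 1 * u η₀ 1
      = (η₀ - η) * ∫ t in (0 : ℝ)..1, h t * (u η t * u η₀ t) := by linarith
  rw [h3]
  exact mul_ne_zero (sub_ne_zero.2 (Ne.symm hηne)) hη

theorem eq_top_of_mem_of_mem {L : Submodule ℝ (Fin 2 → ℝ)} {x y : Fin 2 → ℝ} (hx : x ∈ L)
    (hy : y ∈ L) (hxy : x 0 * y 1 - x 1 * y 0 ≠ 0) : L = ⊤ := by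
  rw [eq_top_iff]
  intro w _
  obtain ⟨D, hD⟩ : ∃ D, D = x 0 * y 1 - x 1 * y 0 := ⟨_, rfl⟩
  rw [← hD] at hxy
  have : w = ((w 0 * y 1 - w 1 * y 0) / D) • x + ((x 0 * w 1 - x 1 * w 0) / D) • y := by
    ext i
    fin_cases i <;> simp <;> field_simp <;> rw [hD] <;> ring
  rw [this]
  exact L.add_mem (L.smul_mem _ hx) (L.smul_mem _ hy)

/-- A set containing the values at points accumulating at `η₀` of a continuous family of matrices
which moves every line is strongly irreducible. -/
theorem isStronglyIrreducible_of_frequently {G : Set (SpecialLinearGroup (Fin 2) ℝ)} {η₀ : ℝ}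
    (hTc : Continuous fun η => (T η : Matrix (Fin 2) (Fin 2) ℝ))
    (hmove : ∀ v : Fin 2 → ℝ, v ≠ 0 → ∀ᶠ η in 𝓝[≠] η₀,
      ((T η : Matrix (Fin 2) (Fin 2) ℝ) *ᵥ v) 0 * ((T η₀ : Matrix (Fin 2) (Fin 2) ℝ) *ᵥ v) 1 -
      ((T η : Matrix (Fin 2) (Fin 2) ℝ) *ᵥ v) 1 * ((T η₀ : Matrix (Fin 2) (Fin 2) ℝ) *ᵥ v) 0
        ≠ 0)
    (hfreq : ∃ᶠ η in 𝓝[≠] η₀, T η ∈ G) : IsStronglyIrreducible G := by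
  rintro ⟨F, hF, ⟨V, hV⟩, hproper, hinv⟩
  obtain ⟨v, hvV, hv⟩ := Submodule.exists_mem_ne_zero_of_ne_bot (hproper V hV).1
  have hev : ∀ L ∈ F, ∀ᶠ η in 𝓝[≠] η₀, (T η : Matrix (Fin 2) (Fin 2) ℝ) *ᵥ v ∉ L := by
    intro L hL
    -- If `T η₀ v` lies on `L`, a non-parallel vector cannot, as `L` is proper. Otherwise continuity
    -- keeps `T η v` off the closed set `L`.
    by_cases h0 : (T η₀ : Matrix (Fin 2) (Fin 2) ℝ) *ᵥ v ∈ L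
    · filter_upwards [hmove v hv] with η hη hmem
      exact (hproper L hL).2 (eq_top_of_mem_of_mem hmem h0 hη)
    · have hc : Continuous fun η => (T η : Matrix (Fin 2) (Fin 2) ℝ) *ᵥ v :=
        hTc.matrix_mulVec continuous_const
      have hcl : IsClosed (L : Set (Fin 2 → ℝ)) := L.closed_of_finiteDimensional
      exact (hc.continuousAt.eventually (hcl.isOpen_compl.mem_nhds h0)).filter_mono
        nhdsWithin_le_nhds
  obtain ⟨η, hηG, hη⟩ := (hfreq.and_eventually ((eventually_all_finite hF).2 hev)).exists
  have hmem : (T η : Matrix (Fin 2) (Fin 2) ℝ) *ᵥ v ∈ ⋃ L ∈ F, (L : Set (Fin 2 → ℝ)) := by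
    rw [← hinv _ hηG]
    exact ⟨v, Set.mem_biUnion hV hvV, rfl⟩
  simp only [Set.mem_iUnion] at hmem
  obtain ⟨L, hL, hmem⟩ := hmem
  exact hη L hL hmem

end

/-! ### Compact groups, invariant forms and non-compactness. -/

section

open Filter Topology

/-- A compact subgroup of `SL(2,ℝ)` leaves a definite quadratic form invariant. -/
theorem exists_invariant_form {G : Subgroup (SpecialLinearGroup (Fin 2) ℝ)}
    (hG : IsCompact (G : Set (SpecialLinearGroup (Fin 2) ℝ))) :
    ∃ a b d : ℝ, 0 < a * d - b * b ∧ ∀ A ∈ G,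
      (A : Matrix (Fin 2) (Fin 2) ℝ) * !![a, b; b, d] * (A : Matrix (Fin 2) (Fin 2) ℝ)ᵀ
        = !![a, b; b, d] := by
  have : CompactSpace G := isCompact_iff_compactSpace.1 hG
  let _ : MeasurableSpace G := borel G
  have : BorelSpace G := ⟨rfl⟩
  let ν : Measure G := Measure.haar
  let e : G → Matrix (Fin 2) (Fin 2) ℝ := fun A => (A.1 : Matrix (Fin 2) (Fin 2) ℝ)
  -- `φ i j A` is the entry `(i, j)` of `A Aᵀ`. Its Haar integral is the invariant form, by left
  -- invariance.
  let φ : Fin 2 → Fin 2 → G → ℝ := fun i j A => e A i 0 * e A j 0 + e A i 1 * e A j 1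
  have hentry : ∀ i j, Continuous fun A : G => e A i j := by
    intro i j
    have : Continuous fun A : SpecialLinearGroup (Fin 2) ℝ => (A : Matrix (Fin 2) (Fin 2) ℝ) :=
      continuous_subtype_val
    exact (this.matrix_elem i j).comp continuous_subtype_val
  have hφ : ∀ i j, Continuous (φ i j) := fun i j =>
    ((hentry i 0).mul (hentry j 0)).add ((hentry i 1).mul (hentry j 1))
  have hint : ∀ i j, Integrable (φ i j) ν := fun i j =>
    (hφ i j).integrable_of_hasCompactSupport (HasCompactSupport.of_compactSpace _)
  have hlin : ∀ r s t : ℝ, ∫ A, (r * φ 0 0 A + s * φ 0 1 A + t * φ 1 1 A) ∂ν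
      = r * (∫ A, φ 0 0 A ∂ν) + s * (∫ A, φ 0 1 A ∂ν) + t * (∫ A, φ 1 1 A ∂ν) := by
    intro r s t
    have h1 : Integrable (fun A => r * φ 0 0 A) ν := (hint 0 0).const_mul r
    have h2 : Integrable (fun A => s * φ 0 1 A) ν := (hint 0 1).const_mul s
    have h3 : Integrable (fun A => t * φ 1 1 A) ν := (hint 1 1).const_mul t
    have h12 : Integrable (fun A => r * φ 0 0 A + s * φ 0 1 A) ν := h1.add h2
    rw [integral_add h12 h3, integral_add h1 h2, integral_const_mul, integral_const_mul,
      integral_const_mul]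
  have hpos : ∀ x y : ℝ, x ≠ 0 ∨ y ≠ 0 →
      0 < x * x * (∫ A, φ 0 0 A ∂ν) + 2 * x * y * (∫ A, φ 0 1 A ∂ν)
        + y * y * (∫ A, φ 1 1 A ∂ν) := by
    intro x y hxy
    have h2 : ∀ A : G, x * x * φ 0 0 A + 2 * x * y * φ 0 1 A + y * y * φ 1 1 A
        = (x * e A 0 0 + y * e A 1 0) ^ 2 + (x * e A 0 1 + y * e A 1 1) ^ 2 := by
      intro A
      simp only [φ]
      ring
    rw [← hlin]
    simp only [h2]
    refine Continuous.integral_pos_of_hasCompactSupport_nonneg_nonzero (x := (1 : G)) ?_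
      (HasCompactSupport.of_compactSpace _) (fun A => by positivity) ?_
    · have := hentry 0 0
      have := hentry 0 1
      have := hentry 1 0
      have := hentry 1 1
      fun_prop
    · have he : e 1 = 1 := rfl
      have hxy' : x ^ 2 + y ^ 2 ≠ 0 := by
        rcases hxy with h | h <;> positivity
      simpa [he] using hxy'
  set a := ∫ A, φ 0 0 A ∂ν with ha
  set b := ∫ A, φ 0 1 A ∂ν with hb
  set d := ∫ A, φ 1 1 A ∂ν with hd
  have ha0 : 0 < a := by simpa using hpos 1 0 (by simp)
  refine ⟨a, b, d, ?_, fun A hA => ?_⟩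
  -- At the vector `(-b, a)` the form takes the value `a (a d - b²)`.
  · have := hpos (-b) a (Or.inr ha0.ne')
    have h2 : 0 < a * (a * d - b * b) := by linarith
    exact (mul_pos_iff_of_pos_left ha0).1 h2
  · set A' : G := ⟨A, hA⟩ with hA'
    have hinv : ∀ i j, ∫ X, φ i j X ∂ν
        = e A' i 0 * e A' j 0 * a + (e A' i 0 * e A' j 1 + e A' i 1 * e A' j 0) * b
          + e A' i 1 * e A' j 1 * d := by
      intro i j
      rw [← integral_mul_left_eq_self (φ i j) A', ← hlin]
      congr 1
      ext X
      have he : e (A' * X) = e A' * e X := rfl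
      simp only [φ, he, Matrix.mul_apply, Fin.sum_univ_two]
      ring
    have h10 : ∫ X, φ 1 0 X ∂ν = b := by
      rw [hb]
      congr 1
      ext X
      simp only [φ]
      ring
    have e00 := hinv 0 0
    have e01 := hinv 0 1
    have e10 := hinv 1 0
    have e11 := hinv 1 1
    rw [← ha] at e00
    rw [← hb] at e01
    rw [h10] at e10
    rw [← hd] at e11
    change e A' * !![a, b; b, d] * (e A')ᵀ = _
    ext i j
    fin_cases i <;> fin_cases j <;>
      simp only [Matrix.mul_apply, Fin.sum_univ_two, Matrix.transpose_apply, Matrix.of_apply,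
        Matrix.cons_val', Matrix.cons_val_zero, Matrix.cons_val_one, Fin.zero_eta, Fin.mk_one,
        Matrix.cons_val_fin_one] <;> linarith

/-- Completing the square: `d m = (a d - b²) x² + (b x + d y)²`, and symmetrically for `y`. -/
theorem abs_le_of_quadratic_form {a b d x y m : ℝ}
    (hdet : 0 < a * d - b * b) (h : a * x * x + 2 * b * x * y + d * y * y = m) :
    |x| ≤ √(d * m / (a * d - b * b)) ∧ |y| ≤ √(a * m / (a * d - b * b)) := by
  subst h
  constructor <;> refine Real.abs_le_sqrt ?_ <;> rw [le_div_iff₀ hdet]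
  · nlinarith [sq_nonneg (b * x + d * y)]
  · nlinarith [sq_nonneg (a * x + b * y)]

/-- An invariant form of a family `T` bounds its entries. -/
theorem exists_entry_bound {ι : Type*} {T : ι → Matrix (Fin 2) (Fin 2) ℝ} {a b d : ℝ}
    (hdet : 0 < a * d - b * b)
    (hT : ∀ η, T η * !![a, b; b, d] * (T η)ᵀ = !![a, b; b, d]) (i j : Fin 2) :
    ∃ M, ∀ η, |T η i j| ≤ M := by
  -- The `i`-th diagonal entry of `T Q Tᵀ = Q` fixes the value of the form on the `i`-th row of `T`.
  have key : ∀ η, a * T η i 0 * T η i 0 + 2 * b * T η i 0 * T η i 1 + d * T η i 1 * T η i 1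
      = !![a, b; b, d] i i := by
    intro η
    conv_rhs => rw [← hT η]
    simp only [Matrix.mul_apply, Fin.sum_univ_two, Matrix.transpose_apply, Matrix.of_apply,
        Matrix.cons_val', Matrix.cons_val_zero, Matrix.cons_val_one, Matrix.cons_val_fin_one]
    ring
  have := fun η => abs_le_of_quadratic_form hdet (key η)
  fin_cases j
  · exact ⟨_, fun η => (this η).1⟩
  · exact ⟨_, fun η => (this η).2⟩

variable {g h : ℝ → ℝ} {B C : ℝ}

theorem differentiable_complexTransferMatrix (hg : AEMeasurable g) (hh : AEMeasurable h)
    (hB : ∀ x, |g x| ≤ B) (hC : ∀ x, |h x| ≤ C) (i j : Fin 2) :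
    Differentiable ℂ fun z => complexTransferMatrix (affinePotential g h z) i j := by
  have h01 : (1 : ℝ) ∈ Set.Icc (0 : ℝ) 1 := by simp
  fin_cases i <;> fin_cases j
  · exact differentiable_volterraSolution hg hh hB hC 1 0 h01
  · exact differentiable_volterraSolution hg hh hB hC 0 1 h01
  · exact differentiable_volterraDeriv hg hh hB hC 1 0 h01
  · exact differentiable_volterraDeriv hg hh hB hC 0 1 h01

theorem exists_growth_complexTransferMatrix (hg : AEMeasurable g) (hh : AEMeasurable h)
    (hB : ∀ x, |g x| ≤ B) (hC : ∀ x, |h x| ≤ C) (i j : Fin 2) :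
    ∃ A k : ℝ, ∀ w : ℂ, ‖complexTransferMatrix (affinePotential g h (w ^ 2)) i j‖
      ≤ A * Real.exp (k * ‖w‖) := by
  have h01 : (1 : ℝ) ∈ Set.Icc (0 : ℝ) 1 := by simp
  fin_cases i <;> fin_cases j
  · exact ⟨_, _, norm_volterraSolution_sq_le hB hC 1 0 h01⟩
  · exact ⟨_, _, norm_volterraSolution_sq_le hB hC 0 1 h01⟩
  · exact ⟨_, _, norm_volterraDeriv_sq_le hg hh hB hC 1 0 h01⟩
  · exact ⟨_, _, norm_volterraDeriv_sq_le hg hh hB hC 0 1 h01⟩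

/-- If the transfer matrices lie in a compact group for couplings accumulating at some point, then
they do not depend on the coupling. -/
theorem transferMatrix_const_of_compact (hg : AEMeasurable g) (hh : AEMeasurable h)
    (hB : ∀ x, |g x| ≤ B) (hC : ∀ x, |h x| ≤ C) {T : ℝ → SpecialLinearGroup (Fin 2) ℝ}
    (hT : ∀ η, (T η : Matrix (Fin 2) (Fin 2) ℝ).map Complex.ofReal
      = complexTransferMatrix (affinePotential g h η))
    {G : Subgroup (SpecialLinearGroup (Fin 2) ℝ)}
    (hG : IsCompact (G : Set (SpecialLinearGroup (Fin 2) ℝ))) {η₀ : ℝ}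
    (hfreq : ∃ᶠ η in 𝓝[≠] η₀, T η ∈ G) (η η' : ℝ) : T η = T η' := by
  obtain ⟨a, b, d, hdet, hinv⟩ := exists_invariant_form hG
  set M : ℂ → Matrix (Fin 2) (Fin 2) ℂ :=
    fun z => complexTransferMatrix (affinePotential g h z) with hM
  have hMT : ∀ (η : ℝ) i j, M η i j = ((T η i j : ℝ) : ℂ) := fun η i j => by
    rw [hM]
    dsimp only
    rw [← hT η]
    rfl
  have hdM : ∀ i j, Differentiable ℂ fun z => M z i j :=
    differentiable_complexTransferMatrix hg hh hB hC
  set N : Fin 2 → Fin 2 → ℂ → ℂ := fun i j z =>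
    (M z i 0 * a + M z i 1 * b) * M z j 0 + (M z i 0 * b + M z i 1 * d) * M z j 1 with hN
  have hform : ∀ (A : Matrix (Fin 2) (Fin 2) ℝ) (i j : Fin 2),
      (A * !![a, b; b, d] * Aᵀ) i j
        = (A i 0 * a + A i 1 * b) * A j 0 + (A i 0 * b + A i 1 * d) * A j 1 := by
    intro A i j
    simp [Matrix.mul_apply, Fin.sum_univ_two]
  have hNT : ∀ (η : ℝ) i j, N i j η
      = (((T η : Matrix (Fin 2) (Fin 2) ℝ) * !![a, b; b, d] *
        (T η : Matrix (Fin 2) (Fin 2) ℝ)ᵀ) i j : ℝ) := by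
    intro η i j
    rw [hform]
    simp only [hN, hMT]
    push_cast
    rfl
  -- `N` is the complexified `T Q Tᵀ`, formed with the transpose and not the adjoint, so it is
  -- holomorphic. The identity theorem extends the invariance from the accumulating couplings to all
  -- of `ℂ`.
  have hall : ∀ i j, N i j = fun _ => ((!![a, b; b, d] i j : ℝ) : ℂ) := by
    intro i j
    have hdN : Differentiable ℂ (N i j) := by
      have h1 := hdM i 0
      have h2 := hdM i 1
      have h3 := hdM j 0
      have h4 := hdM j 1
      simp only [hN]
      fun_prop
    refine AnalyticOnNhd.eq_of_frequently_eq (𝕜 := ℂ) (z₀ := (η₀ : ℂ))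
      (fun z _ => hdN.analyticAt z) (fun z _ => analyticAt_const) ?_
    have ht : Tendsto (fun x : ℝ => (x : ℂ)) (𝓝[≠] η₀) (𝓝[≠] (η₀ : ℂ)) := by
      refine tendsto_nhdsWithin_iff.2 ⟨?_, ?_⟩
      · exact (Complex.continuous_ofReal.tendsto η₀).mono_left nhdsWithin_le_nhds
      · filter_upwards [self_mem_nhdsWithin] with x hx
        simpa using hx
    refine ht.frequently (hfreq.mono fun η hη => ?_)
    rw [hNT, hinv _ hη]
  have hreal : ∀ η : ℝ, (T η : Matrix (Fin 2) (Fin 2) ℝ) * !![a, b; b, d] *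
      (T η : Matrix (Fin 2) (Fin 2) ℝ)ᵀ = !![a, b; b, d] := by
    intro η
    ext i j
    have := hNT η i j
    rw [hall i j] at this
    exact (Complex.ofReal_injective this).symm
  ext i j
  obtain ⟨m, hm⟩ := exists_entry_bound hdet hreal i j
  obtain ⟨A, k, hgrowth⟩ := exists_growth_complexTransferMatrix hg hh hB hC i j
  have := apply_eq_apply_of_bounded_on_real_of_exp_sqrt (hdM i j) hgrowth (M := m)
    (fun x => by rw [hMT, Complex.norm_real]; exact hm x) η η'
  rw [hMT, hMT] at this
  exact Complex.ofReal_injective this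

end

/-! ### The main theorem. -/

theorem mainTheorem3
    (W : ℝ → ℝ) (hW_meas : AEMeasurable W) (hW_bdd : ∃ B : ℝ, ∀ x, |W x| ≤ B)
    (hW_per : Function.Periodic W 1)
    (f : ℝ → ℝ) (hf_meas : AEMeasurable f)
    (J : Set ℝ) (hJ_interval : J.OrdConnected) (hJ_nontrivial : J.Nontrivial)
    (hJ_sub : J ⊆ Set.Icc 0 1)
    (c C : ℝ) (hc : 0 < c) (hcC : c ≤ C)
    (hf_lower : ∀ x, J.indicator (fun _ => c) x ≤ f x)
    (hf_upper : ∀ x, f x ≤ (Set.Icc (0 : ℝ) 1).indicator (fun _ => C) x)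
    (μ : Measure ℝ) [IsProbabilityMeasure μ] (hμ : ¬ IsDiscrete μ.support) (E : ℝ) :
    ¬ IsCompact (furstenbergGroup W f μ E : Set (SpecialLinearGroup (Fin 2) ℝ)) ∧
      IsStronglyIrreducible (furstenbergGroup W f μ E : Set (SpecialLinearGroup (Fin 2) ℝ)) := by
  obtain ⟨B, hB⟩ := hW_bdd
  have hC0 : 0 ≤ C := hc.le.trans hcC
  have hf0 : ∀ x, 0 ≤ f x := fun x =>
    (Set.indicator_nonneg (fun _ _ => hc.le) x).trans (hf_lower x)
  have hfC : ∀ x, |f x| ≤ C := fun x => by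
    rw [abs_of_nonneg (hf0 x)]
    exact (hf_upper x).trans (Set.indicator_le_self' (fun _ _ => hC0) x)
  obtain ⟨α, hα, β, hβ, hαβ⟩ := hJ_nontrivial.exists_lt
  have hIJ : Set.Ioo α β ⊆ J := Set.Ioo_subset_Icc_self.trans (hJ_interval.out hα hβ)
  have hpos : ∀ x ∈ Set.Ioo α β, 0 < f x := fun x hx =>
    hc.trans_le (by simpa [Set.indicator_of_mem (hIJ hx)] using hf_lower x)
  set g : ℝ → ℝ := fun x => W x - E with hg
  have hgm : AEMeasurable g := hW_meas.sub_const E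
  have hgB : ∀ x, |g x| ≤ B + |E| := fun x => (abs_sub _ _).trans (by linarith [hB x])
  -- The transfer matrix is needed for every real `η`, not only in the support: boundedness is used
  -- on the whole real line.
  have hex := fun η : ℝ => exists_isTransferMatrix (q := fun x => g x + η * f x)
    (hgm.add (hf_meas.const_mul η)) (abs_affine_le hgB hfC η)
  choose T hT hTc using hex
  simp only [ofReal_affine_eq_affinePotential] at hTc
  -- Without an accumulation point every point of the support would be isolated in it.
  obtain ⟨η₀, hη₀⟩ : ∃ η₀, ∃ᶠ η in nhdsWithin η₀ {η₀}ᶜ, η ∈ μ.support := by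
    by_contra hcon
    refine hμ (IsDiscrete.of_nhdsWithin fun x _ => ?_)
    have hx := Filter.not_frequently.1 fun h => hcon ⟨x, h⟩
    rw [eventually_nhdsWithin_iff] at hx
    rw [Filter.le_pure_iff, mem_nhdsWithin_iff_eventually]
    filter_upwards [hx] with y hy hyS
    by_contra hne
    exact hy hne hyS
  have hfreq : ∃ᶠ η in nhdsWithin η₀ {η₀}ᶜ, T η ∈ furstenbergGroup W f μ E := by
    refine hη₀.mono fun η hη => ?_
    refine Subgroup.le_topologicalClosure _ (Subgroup.subset_closure ⟨η, hη, ?_⟩)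
    convert hT η using 2
    simp only [hg]
    ring
  have hmove := fun (v : Fin 2 → ℝ) (hv : v ≠ 0) =>
    eventually_transfer_not_parallel hgm hf_meas hgB hfC hf0 hαβ (hIJ.trans hJ_sub) hpos hT hv η₀
  refine ⟨fun hcomp => ?_, isStronglyIrreducible_of_frequently ?_ hmove hfreq⟩
  -- If `T` were constant, `T η v` and `T η₀ v` would coincide and their Wronskian would vanish,
  -- against `hmove`.
  · have hconst := transferMatrix_const_of_compact hgm hf_meas hgB hfC hTc hcomp hfreq
    obtain ⟨η, hη⟩ := (hmove ![1, 0] (by simp)).exists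
    apply hη
    rw [hconst η η₀]
    ring
  · refine continuous_matrix fun i j => ?_
    have h1 : (fun η => T η i j)
        = fun η : ℝ => (complexTransferMatrix (affinePotential g f η) i j).re := by
      ext η
      rw [← hTc η]
      rfl
    rw [h1]
    exact Complex.continuous_re.comp
      ((differentiable_complexTransferMatrix hgm hf_meas hgB hfC i j).continuous.comp
        Complex.continuous_ofReal)
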